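/- Let $E=(E^0,E^1,s,r)$ be an arbitrary directed graph: $E^0$ and $E^1$ are sets (vertices and edges) of any cardinality and $s,r\colon E^1\to E^0$ are arbitrary maps. Paths. A vertex $v$ is a sink if $s^{-1}(v)=\varnothing$, an infinite emitter if $s^{-1}(v)$ is infinite, and regular if $s^{-1}(v)$ is finite and nonempty. A finite path of length $n\ge 1$ is a sequence $p=e_1\cdots e_n$ of edges with $r(e_i)=s(e_{i+1})$ for $1\le i<n$; then $|p|=n$, $s(p)=s(e_1)$, $r(p)=r(e_n)$. Vertices $v$ are the paths of length $0$, with $s(v)=r(v)=v$. Let $E^*$ be the set of finite paths and $E^\infty$ the set of infinite paths $e_1e_2\cdots$ (with $r(e_i)=s(e_{i+1})$ for all $i\ge1$), with $s(e_1e_2\cdots)=s(e_1)$. A cycle is a path $e_1\cdots e_n$ with $n\ge 1$, $s(e_1)=r(e_n)$ and $s(e_1),\dots,s(e_n)$ pairwise distinct. An edge $f$ is an exit for $e_1\cdots e_n$ if $s(f)=s(e_i)$ and $f\neq e_i$ for some $1\le i\le n$. A set $H\subseteq E^0$ is hereditary if, for every $e\in E^1$, $s(e)\in H$ implies $r(e)\in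 H$; it is saturated if every regular vertex $v$ with $r(s^{-1}(v))\subseteq H$ belongs to $H$. The graph groupoid. Let $X_E=\{p\in E^*\mid r(p)\text{ is a sink or an infinite emitter}\}\cup E^\infty$ and \[\mathcal G_E=\{(\alpha x,|\alpha|-|\beta|,\beta x)\mid \alpha,\beta\in E^*,\ x\in X_E,\ r(\alpha)=s(x)=r(\beta)\},\] a groupoid under $(x,k,y)(y,l,z)=(x,k+l,z)$ and $(x,k,y)^{-1}=(y,-k,x)$, where $(x,k,y)$ has range $x$ and source $y$; the unit space is $\mathcal G_E^{(0)}=\{(x,0,x)\mid x\in X_E\}$. The topology of $\mathcal G_E$ has as a base the sets $Z(\alpha,\beta,F)=Z(\alpha,\beta)\setminus\bigcup_{e\in F}Z(\alpha e,\beta e)$, where $\alpha,\beta\in E^*$, $r(\alpha)=r(\beta)$, $F\subseteq s^{-1}(r(\alpha))$ is finite, and $Z(\alpha,\beta)=\{(\alpha x,|\alpha|-|\beta|,\beta x)\mid x\in X_E,\ r(\alpha)=s(x)=r(\beta)\}$. The unit space carries the subspace topology. Call $\mathcal G_E$ effective if the interior of $\{(x,k,x)\in\mathcal G_E\}\setminus\mathcal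 G_E^{(0)}$ in $\mathcal G_E$ is empty. Call $\mathcal G_E$ minimal if the only open invariant subsets of $\mathcal G_E^{(0)}$ are $\varnothing$ and $\mathcal G_E^{(0)}$, where $D\subseteq\mathcal G_E^{(0)}$ is invariant if every $\gamma\in\mathcal G_E$ whose source lies in $D$ has its range in $D$. Then: (1) $\mathcal G_E$ is effective if and only if every cycle in $E$ has an exit; (2) $\mathcal G_E$ is minimal if and only if the only hereditary and saturated subsets of $E^0$ are $\varnothing$ and $E^0$. -/

import Mathlib

open CategoryTheory

universe u v w

/-! ### Effective and minimal topological groupoids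

A groupoid is Mathlib's `CategoryTheory.Groupoid C`. Its set of arrows is `Arrow C`, its units are
the identity arrows, and the unit space is identified with the set `C` of objects. -/

section TopologicalGroupoid

/-- The set of units (identity arrows) inside the set of all arrows. -/
def groupoidUnits (C : Type w) [Groupoid.{v} C] : Set (Arrow C) :=
  Set.range fun x : C => Arrow.mk (𝟙 x)

/-- The isotropy subgroupoid: all arrows whose source and range coincide. -/
def groupoidIso (C : Type w) [Groupoid.{v} C] : Set (Arrow C) :=
  {f | f.left = f.right}

/-- A groupoid with a topology on its arrows is effective if the interior of the set of
non-unit isotropy arrows is empty. -/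
def IsEffectiveGroupoid (C : Type w) [Groupoid.{v} C] [TopologicalSpace (Arrow C)] : Prop :=
  interior (groupoidIso C \ groupoidUnits C) = ∅

/-- A set of units is open for the subspace topology that the unit space inherits from the
space of arrows. -/
def IsOpenUnitSet {C : Type w} [Groupoid.{v} C] [τ : TopologicalSpace (Arrow C)]
    (D : Set C) : Prop :=
  @IsOpen C (τ.induced fun x : C => Arrow.mk (𝟙 x)) D

/-- A set of units is invariant if it contains the range of each arrow whose source it
contains. -/
def IsInvariantUnitSet {C : Type w} [Groupoid.{v} C] (D : Set C) : Prop :=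
  ∀ γ : Arrow C, γ.left ∈ D → γ.right ∈ D

/-- A groupoid with a topology on its arrows is minimal if the only open invariant subsets of the
unit space are the empty set and the whole unit space. -/
def IsMinimalGroupoid (C : Type w) [Groupoid.{v} C] [TopologicalSpace (Arrow C)] : Prop :=
  ∀ D : Set C, IsOpenUnitSet D → IsInvariantUnitSet D → D = ∅ ∨ D = Set.univ

end TopologicalGroupoid

/-! ### Directed graphs, paths, cycles, exits, hereditary and saturated sets -/

/-- A directed graph with vertex set `V` and edge set `E` (both of any cardinality; loops and
parallel edges are allowed). -/
structure DirGraph (V : Type u) (E : Type v) where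
  source : E → V
  range : E → V

namespace DirGraph

variable {V : Type u} {E : Type v}

/-- The set `s⁻¹(v)` of edges starting at `v`. -/
def outEdges (G : DirGraph V E) (v : V) : Set E := {e | G.source e = v}

def IsSink (G : DirGraph V E) (v : V) : Prop := G.outEdges v = ∅

def IsInfiniteEmitter (G : DirGraph V E) (v : V) : Prop := (G.outEdges v).Infinite

def IsRegularVertex (G : DirGraph V E) (v : V) : Prop :=
  (G.outEdges v).Nonempty ∧ (G.outEdges v).Finite

/-- `G.IsWalk v l`: consecutive edges of the list `l` fit together, and the first edge, if there
is one, starts at `v`. -/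
def IsWalk (G : DirGraph V E) : V → List E → Prop
  | _, [] => True
  | v, e :: l => G.source e = v ∧ G.IsWalk (G.range e) l

/-- The vertex where the walk along the list of edges from `v` ends. -/
def walkEnd (G : DirGraph V E) : V → List E → V
  | v, [] => v
  | _, e :: l => G.walkEnd (G.range e) l

theorem isWalk_append (G : DirGraph V E) {v : V} {l m : List E} :
    G.IsWalk v (l ++ m) ↔ G.IsWalk v l ∧ G.IsWalk (G.walkEnd v l) m := by
  induction l generalizing v with
  | nil => simp [IsWalk, walkEnd]
  | cons e l ih => simp [IsWalk, walkEnd, ih, and_assoc]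

theorem walkEnd_append (G : DirGraph V E) (v : V) (l m : List E) :
    G.walkEnd v (l ++ m) = G.walkEnd (G.walkEnd v l) m := by
  induction l generalizing v with
  | nil => rfl
  | cons e l ih => simp [walkEnd, ih]

/-- A finite path: a vertex (where the path starts) and a list of composable edges from there.
With the empty list it is the path of length `0` at that vertex. -/
@[ext]
structure Path (G : DirGraph V E) where
  start : V
  edges : List E
  isWalk : G.IsWalk start edges

namespace Path

variable {G : DirGraph V E}

/-- The range `r(p)`: the vertex where the path ends. -/
def finish (p : G.Path) : V := G.walkEnd p.start p.edges

def length (p : G.Path) : ℕ := p.edges.length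

/-- The path `p q`. -/
def append (p q : G.Path) (h : p.finish = q.start) : G.Path where
  start := p.start
  edges := p.edges ++ q.edges
  isWalk := G.isWalk_append.2 ⟨p.isWalk, by
    have hq := q.isWalk
    rw [← h] at hq
    exact hq⟩

/-- The path `p e`, for an edge `e` that starts where `p` ends. -/
def snoc (p : G.Path) (e : E) (h : G.source e = p.finish) : G.Path where
  start := p.start
  edges := p.edges ++ [e]
  isWalk := G.isWalk_append.2 ⟨p.isWalk, h, trivial⟩

/-- A cycle: a path of positive length that ends where it starts and whose edges have
pairwise distinct sources. -/
def IsCycle (p : G.Path) : Prop :=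
  0 < p.length ∧ p.start = p.finish ∧ (p.edges.map G.source).Nodup

/-- The edge `f` is an exit for `p` if it has the same source as some edge of `p` from which it
differs. -/
def IsExit (p : G.Path) (f : E) : Prop :=
  ∃ e ∈ p.edges, G.source f = G.source e ∧ f ≠ e

theorem append_finish (p q : G.Path) (h : p.finish = q.start) :
    (p.append q h).finish = q.finish := by
  simp only [finish, append] at h ⊢
  rw [walkEnd_append, h]

end Path

def IsHereditary (G : DirGraph V E) (H : Set V) : Prop :=
  ∀ e : E, G.source e ∈ H → G.range e ∈ H

def IsSaturated (G : DirGraph V E) (H : Set V) : Prop :=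
  ∀ v : V, G.IsRegularVertex v → (∀ e ∈ G.outEdges v, G.range e ∈ H) → v ∈ H

/-- An infinite path `e₀ e₁ e₂ …`. -/
@[ext]
structure InfPath (G : DirGraph V E) where
  edges : Stream' E
  composable : ∀ i : ℕ, G.range (edges i) = G.source (edges (i + 1))

/-- The infinite path `p x`, for a finite path `p` and an infinite path `x` that starts where `p`
ends. -/
def InfPath.prepend {G : DirGraph V E} (p : G.Path) (x : G.InfPath)
    (h : p.finish = G.source (x.edges 0)) : G.InfPath where
  edges := p.edges ++ₛ x.edges
  composable := by
    obtain ⟨a, l, hl⟩ := p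
    simp only [Path.finish] at h ⊢
    induction l generalizing a with
    | nil => exact x.composable
    | cons e l ih =>
      intro i
      cases i with
      | zero =>
        cases l with
        | nil => exact h
        | cons f l => exact hl.2.1.symm
      | succ i => exact ih (G.range e) hl.2 h i

/-! ### The groupoid of a directed graph -/

/-- The set `X_E`: all finite paths that end at a sink or at an infinite emitter, and all
infinite paths. -/
inductive BoundaryPath (G : DirGraph V E) : Type (max u v)
  | finite (p : G.Path) (h : G.IsSink p.finish ∨ G.IsInfiniteEmitter p.finish) : BoundaryPath G
  | infinite (p : G.InfPath) : BoundaryPath G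

namespace BoundaryPath

variable {G : DirGraph V E}

/-- The vertex `s(x)` where a boundary path starts. -/
def start : G.BoundaryPath → V
  | finite p _ => p.start
  | infinite p => G.source (p.edges 0)

/-- The boundary path `p x`, for a finite path `p` and a boundary path `x` that starts where `p`
ends. -/
def prepend (p : G.Path) : (x : G.BoundaryPath) → p.finish = x.start → G.BoundaryPath
  | finite q hq, h => finite (p.append q h) ((Path.append_finish p q h).symm ▸ hq)
  | infinite q, h => infinite (q.prepend p h)

theorem start_prepend (p : G.Path) (x : G.BoundaryPath) (h : p.finish = x.start) :
    (x.prepend p h).start = p.start := by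
  cases x with
  | finite q hq => rfl
  | infinite q =>
    obtain ⟨v, l, hl⟩ := p
    cases l with
    | nil => exact h.symm
    | cons e l => exact hl.1

end BoundaryPath

/-- The set `Z(α, β)` of all triples `(α x, |α| - |β|, β x)`. -/
def cylinder (G : DirGraph V E) (α β : G.Path) : Set (G.BoundaryPath × ℤ × G.BoundaryPath) :=
  {g | ∃ (x : G.BoundaryPath) (hα : α.finish = x.start) (hβ : β.finish = x.start),
    g = (x.prepend α hα, (α.length : ℤ) - (β.length : ℤ), x.prepend β hβ)}

/-- The set `Z(α, β, F)`, which is `Z(α, β)` without all `Z(α e, β e)` for `e` in the finite set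
`F` of edges that start at `r(α) = r(β)`. -/
def basicOpen (G : DirGraph V E) (α β : G.Path) (h : α.finish = β.finish)
    (F : Finset {e : E // G.source e = α.finish}) :
    Set (G.BoundaryPath × ℤ × G.BoundaryPath) :=
  G.cylinder α β \ ⋃ e ∈ F, G.cylinder (α.snoc e.1 e.2) (β.snoc e.1 (e.2.trans h))

/-- The set of arrows of the graph groupoid: all triples `(α x, |α| - |β|, β x)` for finite paths
`α`, `β` and boundary paths `x` with `r(α) = s(x) = r(β)`. -/
def groupoidTriples (G : DirGraph V E) : Set (G.BoundaryPath × ℤ × G.BoundaryPath) :=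
  {g | ∃ α β : G.Path, g ∈ G.cylinder α β}

/-! Helper facts: the set of arrows is closed under composition. -/

theorem stream_append_cancel {l m : List E} {a b : Stream' E} (h : l ++ₛ a = m ++ₛ b)
    (hl : l.length ≤ m.length) : ∃ t, m = l ++ t ∧ a = t ++ₛ b := by
  induction l generalizing m with
  | nil => exact ⟨m, rfl, h⟩
  | cons e l ih =>
    cases m with
    | nil => simp at hl
    | cons f m =>
      have h0 : e = f := congrArg Stream'.head h
      have h1 : l ++ₛ a = m ++ₛ b := congrArg Stream'.tail h
      obtain ⟨t, rfl, ht⟩ := ih h1 (by simpa using hl)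
      exact ⟨t, by simp [h0], ht⟩

theorem list_append_cancel {l m a b : List E} (h : l ++ a = m ++ b)
    (hl : l.length ≤ m.length) : ∃ t, m = l ++ t ∧ a = t ++ b := by
  induction l generalizing m with
  | nil => exact ⟨m, rfl, h⟩
  | cons e l ih =>
    cases m with
    | nil => simp at hl
    | cons f m =>
      simp only [List.cons_append, List.cons.injEq] at h
      obtain ⟨t, rfl, ht⟩ := ih h.2 (by simpa using hl)
      exact ⟨t, by simp [h.1], ht⟩

theorem Path.append_split {G : DirGraph V E} {β γ : G.Path} {t : List E}
    (hs : β.start = γ.start) (ht : γ.edges = β.edges ++ t) :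
    ∃ (μ : G.Path) (h : β.finish = μ.start), μ.edges = t ∧ γ = β.append μ h := by
  obtain ⟨v, l, hl⟩ := β
  obtain ⟨w, m, hm⟩ := γ
  obtain rfl : v = w := hs
  obtain rfl : m = l ++ t := ht
  exact ⟨⟨G.walkEnd v l, t, (G.isWalk_append.1 hm).2⟩, rfl, rfl, rfl⟩

theorem prepend_cancel {G : DirGraph V E} {β γ : G.Path} {x y : G.BoundaryPath}
    (hβ : β.finish = x.start) (hγ : γ.finish = y.start)
    (h : x.prepend β hβ = y.prepend γ hγ) (hl : β.length ≤ γ.length) :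
    ∃ (μ : G.Path) (h₁ : β.finish = μ.start) (h₂ : μ.finish = y.start),
      γ = β.append μ h₁ ∧ x = y.prepend μ h₂ := by
  cases x with
  | finite p hp =>
    cases y with
    | infinite q => simp [BoundaryPath.prepend] at h
    | finite q hq =>
      simp only [BoundaryPath.prepend, BoundaryPath.finite.injEq, Path.append, Path.mk.injEq] at h
      obtain ⟨t, ht, hpq⟩ := list_append_cancel h.2 hl
      obtain ⟨μ, h₁, rfl, hμ⟩ := Path.append_split h.1 ht
      have h₂ : μ.finish = q.start := by
        rw [← Path.append_finish β μ h₁, ← hμ]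
        exact hγ
      refine ⟨μ, h₁, h₂, hμ, ?_⟩
      simp only [BoundaryPath.prepend, BoundaryPath.finite.injEq]
      exact Path.ext (hβ.symm.trans h₁) hpq
  | infinite p =>
    cases y with
    | finite q hq => simp [BoundaryPath.prepend] at h
    | infinite q =>
      have hs : β.start = γ.start := by
        have := congrArg BoundaryPath.start h
        rwa [BoundaryPath.start_prepend, BoundaryPath.start_prepend] at this
      simp only [BoundaryPath.prepend, BoundaryPath.infinite.injEq, InfPath.prepend,
        InfPath.mk.injEq] at h
      obtain ⟨t, ht, hpq⟩ := stream_append_cancel h hl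
      obtain ⟨μ, h₁, rfl, hμ⟩ := Path.append_split hs ht
      have h₂ : μ.finish = G.source (q.edges 0) := by
        rw [← Path.append_finish β μ h₁, ← hμ]
        exact hγ
      refine ⟨μ, h₁, h₂, hμ, ?_⟩
      simp only [BoundaryPath.prepend, BoundaryPath.infinite.injEq]
      exact InfPath.ext hpq

theorem prepend_prepend {G : DirGraph V E} {α μ : G.Path} {y : G.BoundaryPath}
    (h₁ : α.finish = μ.start) (h₂ : μ.finish = y.start)
    (h₃ : α.finish = (y.prepend μ h₂).start) (h₄ : (α.append μ h₁).finish = y.start) :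
    (y.prepend μ h₂).prepend α h₃ = y.prepend (α.append μ h₁) h₄ := by
  cases y with
  | finite q hq => simp [BoundaryPath.prepend, Path.append]
  | infinite q => simp [BoundaryPath.prepend, InfPath.prepend, Path.append,
      Stream'.append_append_stream]

theorem one_mem_groupoidTriples (G : DirGraph V E) (x : G.BoundaryPath) :
    (x, (0 : ℤ), x) ∈ G.groupoidTriples := by
  refine ⟨⟨x.start, [], trivial⟩, ⟨x.start, [], trivial⟩, x, rfl, rfl, ?_⟩
  cases x with
  | finite p hp => simp [BoundaryPath.prepend, Path.append, Path.length, BoundaryPath.start]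
  | infinite p => simp [BoundaryPath.prepend, InfPath.prepend, Path.length]

theorem inv_mem_groupoidTriples {G : DirGraph V E} {x y : G.BoundaryPath} {k : ℤ}
    (h : (x, k, y) ∈ G.groupoidTriples) : (y, -k, x) ∈ G.groupoidTriples := by
  obtain ⟨α, β, z, hα, hβ, h⟩ := h
  simp only [Prod.mk.injEq] at h
  obtain ⟨rfl, rfl, rfl⟩ := h
  exact ⟨β, α, z, hβ, hα, by simp⟩

theorem mul_mem_groupoidTriples_aux {G : DirGraph V E} {α β γ δ : G.Path} {x y : G.BoundaryPath}
    (hα : α.finish = x.start) (hβ : β.finish = x.start) (hγ : γ.finish = y.start)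
    (hδ : δ.finish = y.start) (h : x.prepend β hβ = y.prepend γ hγ)
    (hl : β.length ≤ γ.length) :
    (x.prepend α hα, ((α.length : ℤ) - β.length) + (γ.length - δ.length), y.prepend δ hδ) ∈
      G.groupoidTriples := by
  obtain ⟨μ, h₁, h₂, rfl, rfl⟩ := prepend_cancel hβ hγ h hl
  have h₃ : α.finish = μ.start := by rw [hα, ← hβ, h₁]
  have h₄ : (α.append μ h₃).finish = y.start := by rw [Path.append_finish, h₂]
  refine ⟨α.append μ h₃, δ, y, h₄, hδ, ?_⟩
  rw [prepend_prepend h₃ h₂ hα h₄]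
  simp only [Path.append, Path.length, List.length_append, Prod.mk.injEq, true_and, and_true]
  push_cast
  ring

theorem mul_mem_groupoidTriples {G : DirGraph V E} {x y z : G.BoundaryPath} {k l : ℤ}
    (h : (x, k, y) ∈ G.groupoidTriples) (h' : (y, l, z) ∈ G.groupoidTriples) :
    (x, k + l, z) ∈ G.groupoidTriples := by
  obtain ⟨α, β, a, hα, hβ, h⟩ := h
  obtain ⟨γ, δ, b, hγ, hδ, h'⟩ := h'
  simp only [Prod.mk.injEq] at h h'
  obtain ⟨rfl, rfl, rfl⟩ := h
  obtain ⟨h, rfl, rfl⟩ := h'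
  rcases le_total β.length γ.length with hl | hl
  · exact mul_mem_groupoidTriples_aux hα hβ hγ hδ h hl
  · have := inv_mem_groupoidTriples (mul_mem_groupoidTriples_aux hδ hγ hβ hα h.symm hl)
    convert this using 3
    ring

/-- The graph groupoid: its units are the boundary paths, and the arrows with source `x` and range
`y` are the triples `(y, k, x)` in `G.groupoidTriples`, each given by its integer `k`. Composition
is `(z, l, y) (y, k, x) = (z, l + k, x)` and inversion is `(y, k, x)⁻¹ = (x, -k, y)`. -/
instance graphGroupoid (G : DirGraph V E) : Groupoid.{0} G.BoundaryPath where
  Hom x y := {k : ℤ // (y, k, x) ∈ G.groupoidTriples}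
  id x := ⟨0, G.one_mem_groupoidTriples x⟩
  comp f g := ⟨g.1 + f.1, mul_mem_groupoidTriples g.2 f.2⟩
  inv f := ⟨-f.1, inv_mem_groupoidTriples f.2⟩
  id_comp f := Subtype.ext (add_zero f.1)
  comp_id f := Subtype.ext (zero_add f.1)
  assoc f g h := Subtype.ext (add_assoc h.1 g.1 f.1).symm
  inv_comp f := Subtype.ext (add_neg_cancel f.1)
  comp_inv f := Subtype.ext (neg_add_cancel f.1)

/-- The triple `(y, k, x)` that an arrow of the graph groupoid with source `x` and range `y`
is. -/
def arrowTriple {G : DirGraph V E} (f : Arrow G.BoundaryPath) :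
    G.BoundaryPath × ℤ × G.BoundaryPath :=
  (f.right, f.hom.1, f.left)

/-- The topology on the arrows of the graph groupoid that has the sets `Z(α, β, F)` as a base. -/
instance graphGroupoidTopology (G : DirGraph V E) : TopologicalSpace (Arrow G.BoundaryPath) :=
  TopologicalSpace.generateFrom
    {U | ∃ (α β : G.Path) (h : α.finish = β.finish)
      (F : Finset {e : E // G.source e = α.finish}), U = arrowTriple ⁻¹' G.basicOpen α β h F}

end DirGraph

/-! Everything rests on comparing prefixes: if `βx = γy` with `|β| ≤ |γ|`, then `γ = βμ` and `x =
μy` (`prepend_cancel`). It shows that the sets `Z(α, β, F)` form a base and that a basic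
neighbourhood of a unit has `α = β`.

Minimality. For a nonempty open invariant `D`, the vertices from which all boundary paths lie in `D`
form a hereditary saturated set `H`. It is nonempty because `D` contains a basic set: either some
edge at its base vertex is not deleted, and the range of that edge is in `H`, or the base vertex is
a sink and is itself in `H`. Conversely, for hereditary `H` the boundary paths that meet `H` form an
open invariant set. If `H` is saturated and omits `v`, some boundary path from `v` avoids `H`: at
each regular vertex outside `H` an edge leads outside `H`, and at a singular vertex the path may
stop (`exists_boundaryPath_staysIn`).

Effectiveness. From a vertex on a cycle `c` without exit there is only one boundary path, so the
nonempty open set `Z(c, r(c))` consists of isotropy, of lag `|c| ≠ 0`. Conversely, suppose that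
every cycle has an exit and that a nonempty `Z(α, β, F)` consists of non-unit isotropy. Equal
lengths force `α = β`, hence units. Otherwise one of the two paths extends the other by a closed
path `γ`, and `γx = x` for all admissible `x`. But `γ` contains the edges of a cycle, and an `x`
that follows `γ` once and leaves it by an exit on the second round is not fixed
(`not_forall_prepend_eq_self`). -/

namespace DirGraph

variable {V : Type u} {E : Type v} {G : DirGraph V E}

/-! ### Elementary paths and decompositions of boundary paths -/

/-- The path of length `0` at a vertex. -/
def Path.trivialAt (G : DirGraph V E) (v : V) : G.Path := ⟨v, [], trivial⟩

/-- The path of length `1` along an edge. -/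
def Path.single (G : DirGraph V E) (e : E) : G.Path := ⟨G.source e, [e], rfl, trivial⟩

theorem prepend_eq_self (x : G.BoundaryPath) (p : G.Path) (hp : p.edges = [])
    (h : p.finish = x.start) : x.prepend p h = x := by
  obtain ⟨v, l, hl⟩ := p
  obtain rfl : l = [] := hp
  obtain rfl : v = x.start := h
  cases x with
  | finite p hp => simp [BoundaryPath.prepend, Path.append, BoundaryPath.start]
  | infinite p => simp [BoundaryPath.prepend, InfPath.prepend]

theorem prepend_left_cancel {α : G.Path} {x y : G.BoundaryPath} (hx : α.finish = x.start)
    (hy : α.finish = y.start) (h : x.prepend α hx = y.prepend α hy) : x = y := by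
  obtain ⟨μ, h₁, h₂, hα, rfl⟩ := prepend_cancel hx hy h le_rfl
  refine prepend_eq_self y μ ?_ h₂
  simpa [Path.append] using congrArg Path.edges hα

theorem eq_of_prepend_eq_of_length_eq {α β : G.Path} {x y : G.BoundaryPath}
    (hx : α.finish = x.start) (hy : β.finish = y.start) (h : x.prepend α hx = y.prepend β hy)
    (hl : α.length = β.length) : α = β ∧ x = y := by
  obtain ⟨μ, h₁, h₂, rfl, rfl⟩ := prepend_cancel hx hy h hl.le
  have hμ : μ.edges = [] := by
    simpa [Path.append, Path.length] using hl
  exact ⟨Path.ext rfl (by simp [Path.append, hμ]), prepend_eq_self y μ hμ h₂⟩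

/-- The boundary path `x` starts with the edge `e`. -/
def BoundaryPath.StartsWith (x : G.BoundaryPath) (e : E) : Prop :=
  ∃ (y : G.BoundaryPath) (h : (Path.single G e).finish = y.start), x = y.prepend (Path.single G e) h

theorem BoundaryPath.startsWith_prepend {p : G.Path} {e : E} {l : List E} (hp : p.edges = e :: l)
    (x : G.BoundaryPath) (h : p.finish = x.start) : (x.prepend p h).StartsWith e := by
  obtain ⟨v, m, hm⟩ := p
  obtain rfl : m = e :: l := hp
  obtain ⟨rfl, hl⟩ := hm
  refine ⟨x.prepend ⟨G.range e, l, hl⟩ h,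
    (start_prepend ⟨G.range e, l, hl⟩ x h).symm, ?_⟩
  exact (prepend_prepend (α := Path.single G e) (μ := ⟨G.range e, l, hl⟩) rfl h _ h).symm

theorem BoundaryPath.StartsWith.source_eq {x : G.BoundaryPath} {e : E} (h : x.StartsWith e) :
    G.source e = x.start := by
  obtain ⟨y, hy, rfl⟩ := h
  exact (start_prepend (Path.single G e) y hy).symm

theorem BoundaryPath.StartsWith.unique {x : G.BoundaryPath} {e f : E} (he : x.StartsWith e)
    (hf : x.StartsWith f) : e = f := by
  obtain ⟨y, hy, rfl⟩ := he
  obtain ⟨z, hz, h⟩ := hf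
  simpa [Path.single] using congrArg Path.edges (eq_of_prepend_eq_of_length_eq hy hz h rfl).1

/-- The first case covers the paths of length `0`. The cases may overlap, since a path from an
infinite emitter can also have a first edge. -/
theorem BoundaryPath.trivial_or_startsWith (x : G.BoundaryPath) :
    (G.IsSink x.start ∨ G.IsInfiniteEmitter x.start) ∨ ∃ e, x.StartsWith e := by
  cases x with
  | finite p hp =>
    obtain ⟨v, l, hl⟩ := p
    cases l with
    | nil =>
      exact .inl hp
    | cons e l =>
      obtain ⟨rfl, hl'⟩ := hl
      exact .inr ⟨e, .finite ⟨G.range e, l, hl'⟩ hp, rfl, rfl⟩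
  | infinite p =>
    refine .inr ⟨p.edges 0, .infinite ⟨p.edges.tail, fun i => p.composable (i + 1)⟩,
      p.composable 0, ?_⟩
    simp only [prepend, infinite.injEq]
    refine InfPath.ext ?_
    exact (Stream'.eta p.edges).symm

theorem not_isRegularVertex_iff {v : V} :
    ¬ G.IsRegularVertex v ↔ G.IsSink v ∨ G.IsInfiniteEmitter v := by
  rw [IsRegularVertex, IsSink, IsInfiniteEmitter, not_and_or, Set.not_nonempty_iff_eq_empty]
  rfl

/-- Every vertex of `x` satisfies `P`. -/
def BoundaryPath.StaysIn (x : G.BoundaryPath) (P : V → Prop) : Prop :=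
  ∀ (α : G.Path) (y : G.BoundaryPath) (h : α.finish = y.start), x = y.prepend α h → P y.start

theorem InfPath.source_edges_of_eq_prepend {x : G.InfPath} {α : G.Path} {y : G.BoundaryPath}
    {h : α.finish = y.start} (hx : .infinite x = y.prepend α h) :
    y.start = G.source (x.edges α.length) := by
  cases y with
  | finite q hq => simp [BoundaryPath.prepend] at hx
  | infinite q =>
    simp only [BoundaryPath.prepend, BoundaryPath.infinite.injEq] at hx
    subst hx
    have : (α.edges ++ₛ q.edges) (α.edges.length + 0) = q.edges 0 :=
      Stream'.get_append_right 0 α.edges q.edges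
    simp only [BoundaryPath.start, InfPath.prepend, Path.length]
    rw [← this]; rfl

/-- Keep choosing edges that preserve `P`. The walk either stops at a singular vertex or continues
forever, and both outcomes are boundary paths. -/
theorem exists_boundaryPath_staysIn (P : V → Prop)
    (hP : ∀ v, P v → G.IsRegularVertex v → ∃ e, G.source e = v ∧ P (G.range e)) (v : V) (hv : P v) :
    ∃ x : G.BoundaryPath, x.start = v ∧ x.StaysIn P := by
  by_contra hcon
  -- Arguing with the bad vertices avoids treating walks that stop: a bad vertex must be regular,
  -- and its chosen edge leads to a bad vertex, so iteration gives an infinite path inside `P`.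
  let T : Set V := {v | P v ∧ ¬ ∃ x : G.BoundaryPath, x.start = v ∧ x.StaysIn P}
  have step : ∀ w : T, ∃ e : E, G.source e = w ∧ G.range e ∈ T := by
    rintro ⟨w, hw, hw'⟩
    have hreg : G.IsRegularVertex w := by
      by_contra hns
      refine hw' ⟨.finite (Path.trivialAt G w) (not_isRegularVertex_iff.1 hns), rfl, ?_⟩
      intro α y h hxy
      cases y with
      | infinite q => simp [BoundaryPath.prepend] at hxy
      | finite q hq =>
        simp only [BoundaryPath.prepend, BoundaryPath.finite.injEq] at hxy
        have hnil : α.edges ++ q.edges = [] := (congrArg Path.edges hxy).symm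
        have hst : w = α.start := congrArg Path.start hxy
        rw [← h, Path.finish, (List.append_eq_nil_iff.1 hnil).1, ← hst]
        exact hw
    obtain ⟨e, rfl, he⟩ := hP w hw hreg
    refine ⟨e, rfl, he, ?_⟩
    rintro ⟨x, hx, hs⟩
    refine hw' ⟨x.prepend (Path.single G e) hx.symm, BoundaryPath.start_prepend _ _ _, ?_⟩
    intro α y h hxy
    -- The vertex in question is either the start `w` or, once the first edge `e` is cancelled, a
    -- vertex of `x`.
    rcases Nat.eq_zero_or_pos α.length with h0 | h0
    · rw [prepend_eq_self y α (List.length_eq_zero_iff.1 h0)] at hxy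
      exact hxy ▸ (BoundaryPath.start_prepend (Path.single G e) x hx.symm).symm ▸ hw
    · obtain ⟨μ, h₁, h₂, -, rfl⟩ := prepend_cancel _ _ hxy h0
      exact hs μ y h₂ rfl
  choose f hf hfT using step
  let s : ℕ → T := fun n => Nat.rec ⟨v, hv, hcon⟩ (fun _ w => ⟨G.range (f w), hfT w⟩) n
  let x : G.InfPath := ⟨fun n => f (s n), fun i => (hf (s (i + 1))).symm⟩
  refine hcon ⟨.infinite x, hf (s 0), ?_⟩
  intro α y h hxy
  rw [InfPath.source_edges_of_eq_prepend hxy]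
  exact (hf (s α.length)).symm ▸ (s α.length).2.1

theorem exists_boundaryPath_start (G : DirGraph V E) (v : V) :
    ∃ x : G.BoundaryPath, x.start = v := by
  obtain ⟨x, hx, -⟩ := exists_boundaryPath_staysIn (G := G) (fun _ => True)
    (fun v _ hv => hv.1.imp fun e he => ⟨he, trivial⟩) v trivial
  exact ⟨x, hx⟩

/-! ### The topology -/

/-- The arrow given by a triple. -/
def tripleArrow {x y : G.BoundaryPath} {k : ℤ} (h : (y, k, x) ∈ G.groupoidTriples) :
    Arrow G.BoundaryPath :=
  Arrow.mk (X := x) (Y := y) ⟨k, h⟩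

theorem mem_groupoidTriples_prepend {α β : G.Path} {x : G.BoundaryPath} (hα : α.finish = x.start)
    (hβ : β.finish = x.start) :
    (x.prepend α hα, (α.length : ℤ) - β.length, x.prepend β hβ) ∈ G.groupoidTriples :=
  ⟨α, β, x, hα, hβ, rfl⟩

theorem arrowTriple_mem (f : Arrow G.BoundaryPath) : arrowTriple f ∈ G.groupoidTriples :=
  f.hom.2

theorem arrowTriple_id (x : G.BoundaryPath) : arrowTriple (Arrow.mk (𝟙 x)) = (x, 0, x) := rfl

theorem Path.snoc_eq_append (α : G.Path) (e : E) (h : G.source e = α.finish) :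
    α.snoc e h = α.append (Path.single G e) h.symm := rfl

theorem mem_cylinder_snoc_iff {α β : G.Path} {x : G.BoundaryPath} (hα : α.finish = x.start)
    (hβ : β.finish = x.start) {e : E} (h : G.source e = α.finish) (h' : G.source e = β.finish) :
    (x.prepend α hα, (α.length : ℤ) - β.length, x.prepend β hβ) ∈
      G.cylinder (α.snoc e h) (β.snoc e h') ↔ x.StartsWith e := by
  constructor
  · rintro ⟨y, h₁, h₂, hg⟩
    simp only [Prod.mk.injEq, Path.snoc_eq_append] at hg
    have hy : (Path.single G e).finish = y.start :=
      (Path.append_finish _ _ h.symm).symm.trans h₁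
    refine ⟨y, hy, ?_⟩
    have h0 := hg.1
    rw [← prepend_prepend h.symm hy (h.symm.trans
      (BoundaryPath.start_prepend (Path.single G e) y hy).symm)] at h0
    exact prepend_left_cancel _ _ h0
  · rintro ⟨y, hy, rfl⟩
    have h₁ := (Path.append_finish α (Path.single G e) h.symm).trans hy
    have h₂ := (Path.append_finish β (Path.single G e) h'.symm).trans hy
    refine ⟨y, h₁, h₂, ?_⟩
    simp only [Path.snoc_eq_append]
    rw [prepend_prepend h.symm hy _ h₁, prepend_prepend h'.symm hy _ h₂]
    simp [Path.length, Path.append, Path.single]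

/-- The deleted cylinders become a condition on the first edge of the common tail alone. -/
theorem mem_basicOpen_iff {α β : G.Path} (h : α.finish = β.finish)
    {F : Finset {e : E // G.source e = α.finish}} {g : G.BoundaryPath × ℤ × G.BoundaryPath} :
    g ∈ G.basicOpen α β h F ↔ ∃ (x : G.BoundaryPath) (hα : α.finish = x.start)
      (hβ : β.finish = x.start), (∀ e ∈ F, ¬ x.StartsWith e) ∧
        g = (x.prepend α hα, (α.length : ℤ) - (β.length : ℤ), x.prepend β hβ) := by
  constructor
  · rintro ⟨⟨x, hα, hβ, rfl⟩, hF⟩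
    refine ⟨x, hα, hβ, fun e he hs => hF ?_, rfl⟩
    exact Set.mem_biUnion he ((mem_cylinder_snoc_iff hα hβ e.2 (e.2.trans h)).2 hs)
  · rintro ⟨x, hα, hβ, hF, rfl⟩
    refine ⟨⟨x, hα, hβ, rfl⟩, fun hU => ?_⟩
    obtain ⟨e, he, hs⟩ := Set.mem_iUnion₂.1 hU
    exact hF e he ((mem_cylinder_snoc_iff hα hβ e.2 (e.2.trans h)).1 hs)

/-- A common arrow forces `(α', β') = (αμ, βμ)`, so the set with longer paths only has to be shrunk
when `μ` is empty. -/
theorem exists_basicOpen_subset_inter_of_length_le {α β α' β' : G.Path} (h : α.finish = β.finish)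
    {F : Finset {e : E // G.source e = α.finish}} (h' : α'.finish = β'.finish)
    {F' : Finset {e : E // G.source e = α'.finish}} {g : G.BoundaryPath × ℤ × G.BoundaryPath}
    (hg : g ∈ G.basicOpen α β h F) (hg' : g ∈ G.basicOpen α' β' h' F')
    (hl : α.length ≤ α'.length) :
    ∃ F'' : Finset {e : E // G.source e = α'.finish}, g ∈ G.basicOpen α' β' h' F'' ∧
      G.basicOpen α' β' h' F'' ⊆ G.basicOpen α β h F ∩ G.basicOpen α' β' h' F' := by
  classical
  have hgmem := hg
  obtain ⟨x, hα, hβ, hF, rfl⟩ := (mem_basicOpen_iff _).1 hg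
  obtain ⟨y, hα', hβ', hF', hxy⟩ := (mem_basicOpen_iff _).1 hg'
  simp only [Prod.mk.injEq] at hxy
  obtain ⟨h₁, h₂, h₃⟩ := hxy
  obtain ⟨μ, hμ, hμ', rfl, rfl⟩ := prepend_cancel hα hα' h₁ hl
  -- Equal lags turn `|α| ≤ |α'|` into `|β| ≤ |β'|`, and then give `|μ| = |ν|`.
  obtain ⟨ν, hν, hν', rfl, hx⟩ := prepend_cancel hβ hβ' h₃ (by omega)
  obtain ⟨rfl, -⟩ := eq_of_prepend_eq_of_length_eq _ _ hx (by
    simp only [Path.append, Path.length, List.length_append] at h₂ ⊢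
    omega)
  rcases hμe : μ.edges with _ | ⟨e, l⟩
  · have ha : α.append μ hμ = α := Path.ext rfl (by simp [Path.append, hμe])
    have hb : β.append μ hν = β := Path.ext rfl (by simp [Path.append, hμe])
    generalize α.append μ hμ = α₁ at *
    generalize β.append μ hν = β₁ at *
    subst ha hb
    refine ⟨F ∪ F', (mem_basicOpen_iff _).2 ⟨y, hα', hβ', ?_, by simp [h₁, h₃]⟩, ?_⟩
    · intro e he
      rcases Finset.mem_union.1 he with he | he
      · rw [prepend_eq_self y μ hμe] at hF
        exact hF e he
      · exact hF' e he
    · intro g hg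
      obtain ⟨z, hz, hz', hzF, rfl⟩ := (mem_basicOpen_iff _).1 hg
      exact ⟨(mem_basicOpen_iff _).2 ⟨z, hz, hz', fun e he => hzF e (Finset.mem_union_left _ he), rfl⟩,
        (mem_basicOpen_iff _).2 ⟨z, hz, hz', fun e he => hzF e (Finset.mem_union_right _ he), rfl⟩⟩
  -- Every tail `μz` has the same first edge `e` as `μy`, and `e ∉ F` because `μy` is admissible. So
  -- `F` excludes nothing here.
  · refine ⟨F', hg', fun g hg => ⟨?_, hg⟩⟩
    obtain ⟨z, hz, hz', hzF, rfl⟩ := (mem_basicOpen_iff _).1 hg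
    have hμz : μ.finish = z.start := (Path.append_finish _ _ hμ).symm.trans hz
    refine (mem_basicOpen_iff _).2 ⟨z.prepend μ hμz,
      hμ.trans (BoundaryPath.start_prepend _ _ _).symm,
      hν.trans (BoundaryPath.start_prepend _ _ _).symm, ?_, ?_⟩
    · intro f hf hs
      have := hs.unique (BoundaryPath.startsWith_prepend hμe z hμz)
      exact hF f hf (this ▸ BoundaryPath.startsWith_prepend hμe y hμ')
    · rw [prepend_prepend hμ hμz _ hz, prepend_prepend hν hμz _ hz']
      simp [Path.length, Path.append]

theorem isTopologicalBasis_basicOpen (G : DirGraph V E) :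
    TopologicalSpace.IsTopologicalBasis
      {U : Set (Arrow G.BoundaryPath) | ∃ (α β : G.Path) (h : α.finish = β.finish)
        (F : Finset {e : E // G.source e = α.finish}),
          U = arrowTriple ⁻¹' G.basicOpen α β h F} where
  exists_subset_inter := by
    rintro _ ⟨α, β, h, F, rfl⟩ _ ⟨α', β', h', F', rfl⟩ f ⟨hf, hf'⟩
    rcases le_total α.length α'.length with hl | hl
    · obtain ⟨F'', h₁, h₂⟩ := exists_basicOpen_subset_inter_of_length_le h h' hf hf' hl
      exact ⟨_, ⟨α', β', h', F'', rfl⟩, h₁, fun f hf => h₂ hf⟩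
    · obtain ⟨F'', h₁, h₂⟩ := exists_basicOpen_subset_inter_of_length_le h' h hf' hf hl
      exact ⟨_, ⟨α, β, h, F'', rfl⟩, h₁, fun f hf => (h₂ hf).symm⟩
  sUnion_eq := by
    refine Set.eq_univ_of_forall fun f => ?_
    obtain ⟨α, β, x, hα, hβ, hf⟩ := arrowTriple_mem f
    exact ⟨_, ⟨α, β, hα.trans hβ.symm, ∅, rfl⟩,
      (mem_basicOpen_iff (hα.trans hβ.symm)).2 ⟨x, hα, hβ, by simp, hf⟩⟩
  eq_generateFrom := rfl

theorem isOpen_preimage_basicOpen (α β : G.Path) (h : α.finish = β.finish)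
    (F : Finset {e : E // G.source e = α.finish}) :
    IsOpen (arrowTriple ⁻¹' G.basicOpen α β h F) :=
  (isTopologicalBasis_basicOpen G).isOpen ⟨α, β, h, F, rfl⟩

/-! ### Open and invariant sets of units -/

theorem isOpenUnitSet_iff {D : Set G.BoundaryPath} :
    IsOpenUnitSet D ↔ ∀ x ∈ D, ∃ (α : G.Path) (F : Finset {e : E // G.source e = α.finish}),
      (∃ (y : G.BoundaryPath) (h : α.finish = y.start), (∀ e ∈ F, ¬ y.StartsWith e) ∧
        x = y.prepend α h) ∧
      ∀ (y : G.BoundaryPath) (h : α.finish = y.start), (∀ e ∈ F, ¬ y.StartsWith e) →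
        y.prepend α h ∈ D := by
  constructor
  · rintro ⟨U, hU, rfl⟩ x hx
    obtain ⟨_, ⟨α, β, h, F, rfl⟩, hf, hsub⟩ :=
      (isTopologicalBasis_basicOpen G).exists_subset_of_mem_open hx hU
    obtain ⟨y, hα, hβ, hF, hy⟩ := (mem_basicOpen_iff h).1 hf
    rw [arrowTriple_id] at hy
    simp only [Prod.mk.injEq] at hy
    obtain ⟨rfl, hk, hy⟩ := hy
    -- A unit has lag `0`, so the two prefixes have equal length and coincide.
    obtain ⟨rfl, -⟩ := eq_of_prepend_eq_of_length_eq hα hβ hy (by omega)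
    refine ⟨α, F, ⟨y, hα, hF, rfl⟩, fun z hz hzF =>
      hsub ((mem_basicOpen_iff rfl).2 ⟨z, hz, hz, hzF, ?_⟩)⟩
    rw [arrowTriple_id, sub_self]
  · intro H
    let _ : TopologicalSpace G.BoundaryPath :=
      (graphGroupoidTopology G).induced fun x => Arrow.mk (𝟙 x)
    change IsOpen D
    refine isOpen_iff_forall_mem_open.2 fun x hx => ?_
    obtain ⟨α, F, ⟨y, hy, hyF, rfl⟩, hD⟩ := H x hx
    refine ⟨_, ?_, ⟨_, isOpen_preimage_basicOpen α α rfl F, rfl⟩,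
      (mem_basicOpen_iff rfl).2 ⟨y, hy, hy, hyF, by rw [arrowTriple_id, sub_self]⟩⟩
    intro z hz
    obtain ⟨t, ht, _, htF, hzt⟩ := (mem_basicOpen_iff rfl).1 hz
    rw [arrowTriple_id] at hzt
    rw [(Prod.mk.inj hzt).1]
    exact hD t ht htF

theorem IsInvariantUnitSet.prepend_mem {D : Set G.BoundaryPath} (hD : IsInvariantUnitSet D)
    {α β : G.Path} {x : G.BoundaryPath} (hα : α.finish = x.start) (hβ : β.finish = x.start)
    (h : x.prepend β hβ ∈ D) : x.prepend α hα ∈ D :=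
  hD (tripleArrow (mem_groupoidTriples_prepend hα hβ)) h

/-- The arrow `(αx, |α|, x)` and its inverse link both paths, so finite prefixes are irrelevant to
invariant sets. -/
theorem IsInvariantUnitSet.prepend_mem_iff {D : Set G.BoundaryPath} (hD : IsInvariantUnitSet D)
    {α : G.Path} {x : G.BoundaryPath} (hα : α.finish = x.start) : x.prepend α hα ∈ D ↔ x ∈ D := by
  have h0 := prepend_eq_self x (Path.trivialAt G x.start) rfl rfl
  constructor
  · intro h
    rw [← h0]
    exact IsInvariantUnitSet.prepend_mem hD _ _ h
  · intro h
    rw [← h0] at h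
    exact IsInvariantUnitSet.prepend_mem hD _ _ h

/-! ### Minimality -/

theorem isMinimalGroupoid_of_forall_hereditary_saturated
    (hG : ∀ H : Set V, G.IsHereditary H → G.IsSaturated H → H = ∅ ∨ H = Set.univ) :
    IsMinimalGroupoid G.BoundaryPath := by
  intro D hopen hinv
  rcases D.eq_empty_or_nonempty with hD | ⟨x, hx⟩
  · exact .inl hD
  refine .inr (Set.eq_univ_of_forall fun y => ?_)
  have hher : G.IsHereditary {v | ∀ x : G.BoundaryPath, x.start = v → x ∈ D} := fun e he x hx =>
    (IsInvariantUnitSet.prepend_mem_iff hinv (α := Path.single G e) hx.symm).1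
      (he _ (BoundaryPath.start_prepend _ _ _))
  have hsat : G.IsSaturated {v | ∀ x : G.BoundaryPath, x.start = v → x ∈ D} := by
    rintro v hv hr x rfl
    rcases x.trivial_or_startsWith with h | ⟨e, he⟩
    · exact (not_isRegularVertex_iff.2 h hv).elim
    · have hs := he.source_eq
      obtain ⟨z, hz, rfl⟩ := he
      exact (IsInvariantUnitSet.prepend_mem_iff hinv hz).2 (hr e hs z hz.symm)
  rcases hG _ hher hsat with h | h
  · exfalso
    obtain ⟨α, F, ⟨z, hz, hzF, rfl⟩, hD⟩ := isOpenUnitSet_iff.1 hopen x hx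
    by_cases hF : ∃ e, ∃ he : G.source e = α.finish, ⟨e, he⟩ ∉ F
    · obtain ⟨e, he, heF⟩ := hF
      refine Set.eq_empty_iff_forall_notMem.1 h (G.range e) fun t ht => ?_
      refine (IsInvariantUnitSet.prepend_mem_iff hinv (α := Path.single G e) ht.symm).1
        ((IsInvariantUnitSet.prepend_mem_iff hinv
          (he.symm.trans (BoundaryPath.start_prepend (Path.single G e) t ht.symm).symm)).1
            (hD _ _ fun f hf hs => heF ?_))
      have : e = f := BoundaryPath.StartsWith.unique ⟨t, ht.symm, rfl⟩ hs
      subst this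
      exact hf
    -- Now `F` contains all edges at `r(α)`, so `z` has no first edge and `r(α)` is no infinite
    -- emitter. It is therefore a sink, and no path from it can start with an edge of `F`.
    · push Not at hF
      refine Set.eq_empty_iff_forall_notMem.1 h (α.finish) fun t ht => ?_
      refine (IsInvariantUnitSet.prepend_mem_iff hinv ht.symm).1 (hD t ht.symm fun f hf hs => ?_)
      rcases z.trivial_or_startsWith with (h0 | h0) | ⟨e, he⟩
      · have : f.1 ∈ G.outEdges z.start := f.2.trans hz
        rw [h0] at this
        exact this
      · refine h0 (((F : Set {e : E // G.source e = α.finish}).toFinite.image Subtype.val).subset ?_)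
        intro e he
        exact ⟨⟨e, he.trans hz.symm⟩, hF e _, rfl⟩
      · exact hzF ⟨e, he.source_eq.trans hz.symm⟩ (hF e _) he
  · have : y.start ∈ {v | ∀ x : G.BoundaryPath, x.start = v → x ∈ D} := h ▸ Set.mem_univ _
    exact this y rfl

theorem IsHereditary.walkEnd_mem {H : Set V} (hH : G.IsHereditary H) {l : List E} {v : V}
    (hl : G.IsWalk v l) (hv : v ∈ H) : G.walkEnd v l ∈ H := by
  induction l generalizing v with
  | nil => exact hv
  | cons e l ih => exact ih hl.2 (hH e (hl.1 ▸ hv))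

/-- The boundary paths that have a vertex in `H`. -/
def boundaryPathsMeeting (G : DirGraph V E) (H : Set V) : Set G.BoundaryPath :=
  {x | ∃ (α : G.Path) (y : G.BoundaryPath) (h : α.finish = y.start), x = y.prepend α h ∧
    y.start ∈ H}

theorem isOpenUnitSet_boundaryPathsMeeting (H : Set V) :
    IsOpenUnitSet (G.boundaryPathsMeeting H) := by
  refine isOpenUnitSet_iff.2 ?_
  rintro _ ⟨α, y, h, rfl, hy⟩
  exact ⟨α, ∅, ⟨y, h, by simp, rfl⟩, fun z hz _ => ⟨α, z, hz, rfl, by rwa [← hz, h]⟩⟩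

theorem IsHereditary.isInvariantUnitSet {H : Set V} (hH : G.IsHereditary H) :
    IsInvariantUnitSet (G.boundaryPathsMeeting H) := by
  rintro γ ⟨α, y, h, hγ, hy⟩
  obtain ⟨β, δ, z, hβ, hδ, hz⟩ := arrowTriple_mem γ
  simp only [arrowTriple, Prod.mk.injEq] at hz
  obtain ⟨h₁, -, h₂⟩ := hz
  rw [h₂] at hγ
  rw [h₁]
  -- The arrow replaces the prefix `δ` by `β`. If the vertex in `H` lies beyond `δ`, it survives;
  -- otherwise heredity carries `H` along `μ` to the start of the tail `z`.
  rcases le_total δ.length α.length with hl | hl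
  · obtain ⟨μ, hμ, hμ', rfl, rfl⟩ := prepend_cancel hδ h hγ hl
    have hβμ := hβ.trans (BoundaryPath.start_prepend _ _ _)
    exact ⟨β.append μ hβμ, y, (Path.append_finish _ _ _).trans hμ',
      prepend_prepend _ _ _ _, hy⟩
  · obtain ⟨μ, hμ, hμ', rfl, rfl⟩ := prepend_cancel h hδ hγ.symm hl
    rw [BoundaryPath.start_prepend] at hy
    exact ⟨β, z, hβ, rfl, hμ' ▸ hH.walkEnd_mem μ.isWalk hy⟩

theorem IsMinimalGroupoid.eq_empty_or_univ (hG : IsMinimalGroupoid G.BoundaryPath) {H : Set V}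
    (hH : G.IsHereditary H) (hs : G.IsSaturated H) : H = ∅ ∨ H = Set.univ := by
  rcases hG _ (isOpenUnitSet_boundaryPathsMeeting H) hH.isInvariantUnitSet with h | h
  · refine .inl (Set.eq_empty_of_forall_notMem fun v hv => ?_)
    obtain ⟨x, rfl⟩ := G.exists_boundaryPath_start v
    refine Set.eq_empty_iff_forall_notMem.1 h x ⟨Path.trivialAt G x.start, x, rfl, ?_, hv⟩
    exact (prepend_eq_self x _ rfl rfl).symm
  · refine .inr (Set.eq_univ_of_forall fun v => ?_)
    by_contra hv
    -- Saturation, read contrapositively, is the hypothesis on regular vertices.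
    obtain ⟨x, -, hx⟩ := exists_boundaryPath_staysIn (G := G) (fun v => v ∉ H) (fun v hv hr => by
      by_contra! hcon
      exact hv (hs v hr hcon)) v hv
    obtain ⟨α, y, hy, hxy, hyH⟩ : x ∈ G.boundaryPathsMeeting H := h ▸ Set.mem_univ x
    exact hx α y hy hxy hyH

/-! ### Effectiveness -/

/-- If every vertex of `S` emits exactly one edge and that edge leads back to `S`, then a boundary
path that starts in `S` is determined by where it starts. -/
theorem eq_of_start_eq_of_outEdges_eq_singleton {S : Set V}
    (hS : ∀ v ∈ S, ∃ e, G.outEdges v = {e} ∧ G.range e ∈ S) {x y : G.BoundaryPath}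
    (hx : x.start ∈ S) (hxy : x.start = y.start) : x = y := by
  have hwalk : ∀ (l : List E) (v : V), v ∈ S → G.IsWalk v l → G.walkEnd v l ∈ S := by
    intro l
    induction l with
    | nil => exact fun v hv _ => hv
    | cons e l ih =>
      rintro v hv ⟨rfl, hl⟩
      obtain ⟨f, hf, hfS⟩ := hS _ hv
      obtain rfl : e = f := hf.subset (show e ∈ G.outEdges (G.source e) from rfl)
      exact ih _ hfS hl
  -- A finite boundary path would end in `S`, where a vertex emits exactly one edge and so is
  -- neither a sink nor an infinite emitter.
  have hfin : ∀ z : G.BoundaryPath, z.start ∈ S → ∃ p, z = .infinite p := by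
    rintro (⟨p, hp⟩ | p) hz
    · obtain ⟨e, he, -⟩ := hS _ (hwalk _ _ hz p.isWalk)
      rcases hp with hp | hp
      · exact (Set.singleton_ne_empty e (he.symm.trans hp)).elim
      · exact (hp (he ▸ Set.finite_singleton e : (G.outEdges p.finish).Finite)).elim
    · exact ⟨p, rfl⟩
  obtain ⟨p, rfl⟩ := hfin x hx
  obtain ⟨q, rfl⟩ := hfin y (hxy ▸ hx)
  have key : ∀ n, G.source (p.edges n) ∈ S ∧ G.source (p.edges n) = G.source (q.edges n) := by
    have hedge : ∀ n, G.source (p.edges n) ∈ S → G.source (p.edges n) = G.source (q.edges n) →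
        p.edges n = q.edges n ∧ G.range (p.edges n) ∈ S := by
      intro n h₁ h₂
      obtain ⟨e, he, heS⟩ := hS _ h₁
      have hp : p.edges n = e := he.subset (show p.edges n ∈ G.outEdges _ from rfl)
      have hq : q.edges n = e := he.subset (show q.edges n ∈ G.outEdges _ from h₂.symm)
      exact ⟨hp.trans hq.symm, hp ▸ heS⟩
    intro n
    induction n with
    | zero => exact ⟨hx, hxy⟩
    | succ n ih =>
      obtain ⟨h₁, h₂⟩ := hedge n ih.1 ih.2
      exact ⟨p.composable n ▸ h₂, by rw [← p.composable n, ← q.composable n, h₁]⟩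
  refine congrArg _ (InfPath.ext (Stream'.ext fun n => ?_))
  obtain ⟨e, he, -⟩ := hS _ (key n).1
  have hp : p.edges n = e := he.subset (show p.edges n ∈ G.outEdges _ from rfl)
  have hq : q.edges n = e := he.subset (show q.edges n ∈ G.outEdges _ from (key n).2.symm)
  exact hp.trans hq.symm

theorem range_mem_sources_or_eq_walkEnd {l : List E} {v : V} (hl : G.IsWalk v l) {e : E}
    (he : e ∈ l) : (∃ f ∈ l, G.source f = G.range e) ∨ G.range e = G.walkEnd v l := by
  induction l generalizing v with
  | nil => simp at he
  | cons f l ih =>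
    rcases List.mem_cons.1 he with rfl | he
    · cases l with
      | nil => exact .inr rfl
      | cons g l => exact .inl ⟨g, by simp, hl.2.1⟩
    · exact (ih hl.2 he).imp (fun ⟨g, hg, h⟩ => ⟨g, List.mem_cons_of_mem _ hg, h⟩) id

theorem Path.IsCycle.eq_of_not_isExit {c : G.Path} (hc : c.IsCycle) (hex : ¬ ∃ f, c.IsExit f)
    {x y : G.BoundaryPath} (hx : c.start = x.start) (hy : c.start = y.start) : x = y := by
  obtain ⟨v, l, hl⟩ := c
  obtain ⟨hpos, hclosed, -⟩ := hc
  have hstart : ∃ e ∈ l, G.source e = v := by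
    cases l with
    | nil => simp [length] at hpos
    | cons e l => exact ⟨e, by simp, hl.1⟩
  refine eq_of_start_eq_of_outEdges_eq_singleton (S := {w | ∃ e ∈ l, G.source e = w}) ?_
    (hx ▸ hstart) (hx.symm.trans hy)
  rintro _ ⟨e, he, rfl⟩
  refine ⟨e, Set.eq_singleton_iff_unique_mem.2 ⟨rfl, fun f hf => ?_⟩, ?_⟩
  · by_contra hne
    exact hex ⟨f, e, he, hf, hne⟩
  · rcases range_mem_sources_or_eq_walkEnd hl he with h | h
    · exact h
    · rw [h, ← show v = G.walkEnd v l from hclosed]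
      exact hstart

theorem IsEffectiveGroupoid.exists_isExit (hG : IsEffectiveGroupoid G.BoundaryPath) {c : G.Path}
    (hc : c.IsCycle) : ∃ f, c.IsExit f := by
  by_contra hex
  have hfin : c.finish = (Path.trivialAt G c.finish).finish := rfl
  have hsub : arrowTriple ⁻¹' G.basicOpen c (Path.trivialAt G c.finish) hfin ∅ ⊆
      groupoidIso G.BoundaryPath \ groupoidUnits G.BoundaryPath := by
    intro f hf
    obtain ⟨x, hx, hx', -, h⟩ := (mem_basicOpen_iff hfin).1 hf
    simp only [arrowTriple, Prod.mk.injEq] at h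
    obtain ⟨h₁, h₂, h₃⟩ := h
    -- Source and range both start at the base of `c`, hence agree; the lag `|c| > 0` excludes
    -- units.
    refine ⟨hc.eq_of_not_isExit hex ?_ ?_, ?_⟩
    · rw [h₃, BoundaryPath.start_prepend]
      exact hc.2.1
    · rw [h₁, BoundaryPath.start_prepend]
    · rintro ⟨y, rfl⟩
      have h0 : (0 : ℤ) = c.length - (0 : ℕ) := h₂
      have := hc.1
      omega
  obtain ⟨x, hx⟩ := G.exists_boundaryPath_start c.finish
  have hmem : tripleArrow (mem_groupoidTriples_prepend hx.symm
      (β := Path.trivialAt G c.finish) hx.symm) ∈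
        interior (groupoidIso G.BoundaryPath \ groupoidUnits G.BoundaryPath) :=
    interior_maximal hsub (isOpen_preimage_basicOpen _ _ hfin ∅)
      ((mem_basicOpen_iff hfin).2 ⟨x, hx.symm, hx.symm, by simp, rfl⟩)
  rw [hG] at hmem
  exact hmem

/-! ### Closed paths, exits and effectiveness -/

theorem exists_append_of_not_nodup_map {A B : Type*} (f : A → B) {l : List A}
    (h : ¬ (l.map f).Nodup) : ∃ l₁ a l₂ b l₃, l = l₁ ++ a :: l₂ ++ b :: l₃ ∧ f a = f b := by
  induction l with
  | nil => simp at h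
  | cons a l ih =>
    rw [List.map_cons, List.nodup_cons, not_and_or, not_not] at h
    rcases h with h | h
    · obtain ⟨b, hb, hab⟩ := List.mem_map.1 h
      obtain ⟨l₂, l₃, rfl⟩ := List.append_of_mem hb
      exact ⟨[], a, l₂, b, l₃, rfl, hab.symm⟩
    · obtain ⟨l₁, c, l₂, b, l₃, rfl, hcb⟩ := ih h
      exact ⟨a :: l₁, c, l₂, b, l₃, rfl, hcb⟩

/-- A repeated source cuts out a shorter closed walk. The inclusion of edges lets an exit of the
cycle be found along the original walk. -/
theorem exists_isCycle_of_closed {l : List E} {v : V} (hl : G.IsWalk v l) (hne : l ≠ [])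
    (hv : G.walkEnd v l = v) : ∃ c : G.Path, c.IsCycle ∧ c.edges ⊆ l := by
  induction hn : l.length using Nat.strong_induction_on generalizing l v with
  | _ n ih =>
    by_cases hnd : (l.map G.source).Nodup
    · exact ⟨⟨v, l, hl⟩, ⟨List.length_pos_iff.2 hne, hv.symm, hnd⟩, fun _ h => h⟩
    · obtain ⟨l₁, a, l₂, b, l₃, rfl, hab⟩ := exists_append_of_not_nodup_map G.source hnd
      obtain ⟨h₁, h₃⟩ := G.isWalk_append.1 hl
      obtain ⟨-, h₂⟩ := G.isWalk_append.1 h₁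
      have hend : G.walkEnd (G.walkEnd v l₁) (a :: l₂) = G.walkEnd v l₁ := by
        rw [← G.walkEnd_append, ← h₃.1, ← hab, h₂.1]
      obtain ⟨c, hc, hcl⟩ := ih (a :: l₂).length (by simp [← hn]; omega) h₂ (by simp) hend rfl
      exact ⟨c, hc, fun e he => by
        have := hcl he
        simp only [List.mem_append]
        exact .inl (.inr this)⟩

/-- If every cycle has an exit and `γ` is a closed path of positive length, then not all boundary
paths in a nonempty basic open set at the base of `γ` can be fixed by `γ`. -/
theorem not_forall_prepend_eq_self (hex : ∀ c : G.Path, c.IsCycle → ∃ f, c.IsExit f) {γ : G.Path}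
    (hγ : γ.finish = γ.start) (hne : γ.edges ≠ []) {F : Set E} {x₀ : G.BoundaryPath}
    (hx₀ : γ.finish = x₀.start) (hF₀ : ∀ e ∈ F, ¬ x₀.StartsWith e) :
    ¬ ∀ (x : G.BoundaryPath) (h : γ.finish = x.start), (∀ e ∈ F, ¬ x.StartsWith e) →
      x.prepend γ h = x := by
  intro H
  obtain ⟨c, hc, hcl⟩ := exists_isCycle_of_closed γ.isWalk hne hγ
  obtain ⟨f, e, he, hsrc, hfe⟩ := hex c hc
  obtain ⟨l₁, l₂, hl⟩ := List.append_of_mem (hcl he)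
  obtain ⟨g, m, hgm⟩ := List.exists_cons_of_ne_nil hne
  -- The given point `x₀ = γx₀` is admissible and starts with `g`.
  have hg : g ∉ F := fun hg => hF₀ g hg (by
    have := BoundaryPath.startsWith_prepend hgm x₀ hx₀
    rwa [H x₀ hx₀ hF₀] at this)
  have hw := γ.isWalk
  rw [hl, isWalk_append] at hw
  -- With `γ = l₁ e l₂`, the test path is `γ l₁ f y`. The initial full round makes it start with `g
  -- ∉ F`; without it, `l₁` could be empty and `f` could lie in `F`.
  let δ : G.Path := ⟨γ.start, γ.edges ++ (l₁ ++ [f]), by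
    refine G.isWalk_append.2 ⟨γ.isWalk, ?_⟩
    rw [show G.walkEnd γ.start γ.edges = γ.start from hγ]
    exact G.isWalk_append.2 ⟨hw.1, hsrc.trans hw.2.1, trivial⟩⟩
  obtain ⟨y, hy⟩ := G.exists_boundaryPath_start δ.finish
  have hst : γ.finish = (y.prepend δ hy.symm).start :=
    hγ.trans (BoundaryPath.start_prepend δ y hy.symm).symm
  have hfix := H (y.prepend δ hy.symm) hst (fun e' he' hs => hg (by
    have : g = e' := (BoundaryPath.startsWith_prepend
      (show δ.edges = g :: (m ++ (l₁ ++ [f])) by simp [δ, hgm]) y hy.symm).unique hs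
    rwa [this]))
  have h₁ : (γ.append δ hγ).finish = y.start := (Path.append_finish γ δ hγ).trans hy.symm
  rw [prepend_prepend (μ := δ) hγ hy.symm hst h₁] at hfix
  -- Comparing `γγ l₁ f` with its prefix `γ l₁ f` right after `γ l₁` gives `e = f`.
  obtain ⟨μ, hμ, hμ', hδ, -⟩ := prepend_cancel hy.symm h₁ hfix.symm
    (by simp [Path.append, Path.length])
  have hedges := congrArg Path.edges hδ
  simp only [Path.append, δ, List.append_assoc, List.append_cancel_left_eq] at hedges
  rw [hl] at hedges
  simp only [List.append_assoc, List.append_cancel_left_eq, List.cons_append,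
    List.cons.injEq] at hedges
  exact hfe hedges.1.symm

theorem not_basicOpen_subset_isotropy_of_length_lt
    (hex : ∀ c : G.Path, c.IsCycle → ∃ f, c.IsExit f) {α β : G.Path} (hlt : β.length < α.length)
    {F : Set E} {x₀ : G.BoundaryPath} (hα₀ : α.finish = x₀.start) (hβ₀ : β.finish = x₀.start)
    (hF₀ : ∀ e ∈ F, ¬ x₀.StartsWith e) :
    ¬ ∀ (x : G.BoundaryPath) (hα : α.finish = x.start) (hβ : β.finish = x.start),
      (∀ e ∈ F, ¬ x.StartsWith e) → x.prepend α hα = x.prepend β hβ := by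
  intro H
  obtain ⟨γ, h₁, h₂, rfl, -⟩ := prepend_cancel hβ₀ hα₀ (H x₀ hα₀ hβ₀ hF₀).symm hlt.le
  have hγ : γ.finish = γ.start := by rw [h₂, ← hβ₀, h₁]
  refine not_forall_prepend_eq_self hex hγ ?_ h₂ hF₀ ?_
  · intro h
    simp [Path.append, Path.length, h] at hlt
  · intro x hx hF
    have hβ : β.finish = x.start := by rw [h₁, ← hγ, hx]
    have hβγ : (β.append γ h₁).finish = x.start := (Path.append_finish _ _ _).trans hx
    have := H x hβγ hβ hF
    rw [← prepend_prepend h₁ hx (h₁.trans (BoundaryPath.start_prepend _ _ _).symm)] at this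
    exact prepend_left_cancel _ _ this

theorem isEffectiveGroupoid_of_forall_exists_isExit
    (hex : ∀ c : G.Path, c.IsCycle → ∃ f, c.IsExit f) : IsEffectiveGroupoid G.BoundaryPath := by
  refine Set.eq_empty_of_forall_notMem fun g hg => ?_
  obtain ⟨_, ⟨α, β, h, F, rfl⟩, hgU, hsub⟩ :=
    (isTopologicalBasis_basicOpen G).exists_subset_of_mem_open hg isOpen_interior
  replace hsub := hsub.trans interior_subset
  obtain ⟨x₀, hα₀, hβ₀, hF₀, hg₀⟩ := (mem_basicOpen_iff h).1 hgU
  -- As a plain set of edges, `F` no longer depends on `α`, so the length argument applies with `α`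
  -- and `β` in either order.
  have hF₁ : ∀ e ∈ Subtype.val '' (F : Set {e : E // G.source e = α.finish}),
      ¬ x₀.StartsWith e := by
    rintro _ ⟨e, he, rfl⟩
    exact hF₀ e he
  have hiso : ∀ (x : G.BoundaryPath) (hα : α.finish = x.start) (hβ : β.finish = x.start),
      (∀ e ∈ Subtype.val '' (F : Set {e : E // G.source e = α.finish}), ¬ x.StartsWith e) →
        x.prepend α hα = x.prepend β hβ := by
    intro x hα hβ hF
    have hmem : tripleArrow (mem_groupoidTriples_prepend hα hβ) ∈
        groupoidIso G.BoundaryPath \ groupoidUnits G.BoundaryPath :=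
      hsub ((mem_basicOpen_iff h).2
        ⟨x, hα, hβ, fun e he => hF e ⟨e, he, rfl⟩, rfl⟩)
    exact hmem.1.symm
  rcases lt_trichotomy β.length α.length with hlt | heq | hlt
  · exact not_basicOpen_subset_isotropy_of_length_lt hex hlt hα₀ hβ₀ hF₁ hiso
  · obtain ⟨rfl, -⟩ := eq_of_prepend_eq_of_length_eq hα₀ hβ₀ (hiso x₀ hα₀ hβ₀ hF₁) heq.symm
    refine (hsub hgU).2 ⟨x₀.prepend α hα₀, ?_⟩
    obtain ⟨a, b, k, hk⟩ := g
    simp only [arrowTriple, sub_self, Prod.mk.injEq] at hg₀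
    obtain ⟨rfl, rfl, rfl⟩ := hg₀
    rfl
  · exact not_basicOpen_subset_isotropy_of_length_lt hex hlt hβ₀ hα₀ hF₁
      fun x hβ hα hF => (hiso x hα hβ hF).symm

end DirGraph

/-- For an arbitrary directed graph: its groupoid is effective if and only if every cycle has an
exit, and minimal if and only if the only hereditary and saturated sets of vertices are the empty
set and the set of all vertices. -/
theorem mainTheorem8 {V : Type u} {E : Type v} (G : DirGraph V E) :
    (IsEffectiveGroupoid G.BoundaryPath ↔ ∀ c : G.Path, c.IsCycle → ∃ f : E, c.IsExit f) ∧
    (IsMinimalGroupoid G.BoundaryPath ↔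
      ∀ H : Set V, G.IsHereditary H → G.IsSaturated H → H = ∅ ∨ H = Set.univ) :=
  ⟨⟨fun h _ hc => DirGraph.IsEffectiveGroupoid.exists_isExit h hc,
    DirGraph.isEffectiveGroupoid_of_forall_exists_isExit⟩,
   ⟨fun h _ hH hs => DirGraph.IsMinimalGroupoid.eq_empty_or_univ h hH hs,
    DirGraph.isMinimalGroupoid_of_forall_hereditary_saturated⟩⟩
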